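/- Let $k$ be a field and let $A$ be a finite-dimensional associative unital $k$-algebra. Write $A\text{-mod}$ for the category of finite-dimensional left $A$-modules and $A\text{-proj}$ for its full subcategory of projective modules. Let $C^b(A\text{-proj})$ be the category of bounded complexes over $A\text{-proj}$, $K^b(A\text{-proj})$ its homotopy category, and $D^b(A\text{-mod})$ the bounded derived category. For $m\ge 0$ let $C_m(A\text{-proj})$ be the full subcategory of $C^b(A\text{-proj})$ of the complexes $X=(X^i,d^i)$ with $X^i=0$ for $i\notin\{0,\dots,m\}$ that are homotopy minimal, i.e. $\operatorname{Im} d^i\subseteq \operatorname{rad}X^{i+1}$ for all $i\in\mathbb Z$. For $X$ in one of these categories, its cohomology dimension vector is $(\dim_k H^i(X))_{i\in\mathbb Z}$, and its cohomological range is $$\mathrm{hr}_k(X)=\max\{\dim_k H^i(X)\mid i\in\mathbb Z\}\cdot\max\{\,j-i+1\mid H^i(X)\ne 0\ne H^j(X)\},$$ which is $0$ if all $H^i(X)$ vanish. An object is indecomposable if it is nonzero and is not isomorphic to a direct sum of two nonzero objects of the category. * $C_m(A\text{-proj})$ is of *finite representation type* if it has only finitely many indecomposable objects up to isomorphism. It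 is of *strongly unbounded type* if there is a strictly increasing sequence $(r_n)_{n\in\mathbb N}$ of natural numbers such that for each $n$ there are, up to isomorphism, infinitely many indecomposable objects of $C_m(A\text{-proj})$ with cohomological range $r_n$. * $K^b(A\text{-proj})$ is *discrete* (respectively, $A$ is *derived discrete*) if for each cohomology dimension vector there are only finitely many objects of $K^b(A\text{-proj})$ (respectively, of $D^b(A\text{-mod})$) with that vector, up to isomorphism. * $K^b(A\text{-proj})$ is *of strongly unbounded type* (respectively, $A$ is *strongly derived unbounded*) if there is a strictly increasing sequence $(r_n)_{n\in\mathbb N}$ of natural numbers such that for each $n$ there are, up to shifts and isomorphism, infinitely many indecomposable objects of $K^b(A\text{-proj})$ (respectively, of $D^b(A\text{-mod})$) with cohomological range $r_n$. * $A$ is *$\mathcal C$-dichotomic* if $C_m(A\text{-proj})$ is of finite representation type for every $m\ge 1$, or $C_{m'}(A\text{-proj})$ is of strongly unbounded type for some $m'\ge 1$. **Proposition.** If $A$ is $\mathcal C$-dichotomic, then $K^b(A\text{-proj})$ is discrete or of strongly unbounded type. Hence the second derived Brauer–Thrall type theorem holds for $A$: $A$ is derived discrete or strongly derived unbounded. 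-/

import Mathlib

open CategoryTheory Limits

universe v w u

namespace DerivedRepType

noncomputable section

section General

variable {C : Type u} [Category.{v} C]

/-- Up to the relation `r`, there are only finitely many objects with the property `P`. -/
def FinitelyManyUpTo (r : C → C → Prop) (P : C → Prop) : Prop :=
  ∃ s : Set C, s.Finite ∧ ∀ X, P X → ∃ Y ∈ s, r X Y

/-- The relation of being isomorphic. -/
def Isomorphic (X Y : C) : Prop := Nonempty (X ≅ Y)

/-- The relation of being isomorphic up to a shift. -/
def IsoUpToShift [HasShift C ℤ] (X Y : C) : Prop := ∃ n : ℤ, Nonempty (X ≅ Y⟦n⟧)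

/-- `X` is indecomposable: it is nonzero, and whenever it is isomorphic to a direct sum
(biproduct) of two objects of `C`, one of these is zero. The existence of all biproducts
in `C` is not required. -/
def IsIndecomposable [Preadditive C] (X : C) : Prop :=
  ¬ IsZero X ∧ ∀ (Y Z : C) (b : BinaryBicone Y Z), Nonempty b.IsBilimit →
    Nonempty (X ≅ b.pt) → IsZero Y ∨ IsZero Z

/-- If all binary biproducts exist, this is the usual notion. -/
theorem isIndecomposable_iff [Preadditive C] [HasBinaryBiproducts C] (X : C) :
    IsIndecomposable X ↔ Indecomposable X := by
  constructor
  · rintro ⟨h0, h⟩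
    exact ⟨h0, fun Y Z i => h Y Z _ ⟨BinaryBiproduct.isBilimit Y Z⟩ ⟨i⟩⟩
  · rintro ⟨h0, h⟩
    refine ⟨h0, fun Y Z b ⟨hb⟩ ⟨i⟩ => h Y Z ?_⟩
    exact i ≪≫ biprod.uniqueUpToIso Y Z hb

/-- The cohomological range `hl * hw` of an object whose cohomology in degree `i` has
dimension `h i`: here `hl` is the largest of these dimensions, and `hw` is the largest
`j - i + 1` with nonzero cohomology in the degrees `i` and `j`. -/
def cohomologicalRange (h : ℤ → ℕ) : ℕ :=
  (⨆ i, h i) * sSup {n : ℕ | ∃ i j : ℤ, h i ≠ 0 ∧ h j ≠ 0 ∧ (n : ℤ) = j - i + 1}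

end General

section Algebra

variable (k : Type w) [Field k] (A : Type u) [Ring A] [Algebra k A]

/-- The dimension over `k` of a finitely generated left `A`-module. -/
def dimK {A : Type u} [Ring A] [Algebra k A] (M : FGModuleCat.{u} A) : ℕ :=
  Module.finrank k ((ModuleCat.restrictScalars (algebraMap k A)).obj M.obj)

/-- The bounded complexes of finitely generated projective left `A`-modules, among all
complexes of finitely generated left `A`-modules. -/
def isCbProj : ObjectProperty (CochainComplex (FGModuleCat.{u} A) ℤ) := fun X =>
  (∀ i, Module.Projective A (X.X i)) ∧ ∃ a b : ℤ, ∀ i, i < a ∨ b < i → IsZero (X.X i)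

/-- A complex is homotopy minimal if the image of each differential is contained in the
radical of its target. -/
def IsHomotopyMinimal {A : Type u} [Ring A] (X : CochainComplex (FGModuleCat.{u} A) ℤ) : Prop :=
  ∀ i : ℤ, LinearMap.range (X.d i (i + 1)).hom.hom ≤ Module.jacobson A (X.X (i + 1))

/-- The homotopy minimal complexes of finitely generated projective left `A`-modules which
are concentrated in the degrees `0, …, m`. -/
def isCm (m : ℕ) : ObjectProperty (CochainComplex (FGModuleCat.{u} A) ℤ) := fun X =>
  isCbProj A X ∧ IsHomotopyMinimal X ∧ ∀ i : ℤ, i < 0 ∨ (m : ℤ) < i → IsZero (X.X i)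

/-- The category `C_m(A-proj)`. -/
abbrev Cm (m : ℕ) := (isCm A m).FullSubcategory

/-- The objects of `K^b(A-proj)` in the homotopy category of complexes of finitely generated
left `A`-modules. -/
def isKbProj : ObjectProperty (HomotopyCategory (FGModuleCat.{u} A) (ComplexShape.up ℤ)) :=
  fun X => isCbProj A X.as

/-- The category `K^b(A-proj)`. -/
abbrev Kb := (isKbProj A).FullSubcategory

/-- `C_m(A-proj)` is of finite representation type. -/
def CmFinite (m : ℕ) : Prop :=
  FinitelyManyUpTo Isomorphic fun X : Cm A m => IsIndecomposable X

variable [IsNoetherianRing A]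

/-- The category `D^b(A-mod)`. -/
abbrev Db [HasDerivedCategory.{v} (FGModuleCat.{u} A)] :=
  DerivedCategory.Bounded (FGModuleCat.{u} A)

/-- `i ↦ dim_k H^i(X)` for `X` in `C_m(A-proj)`. -/
def Cm.dimH {A : Type u} [Ring A] [Algebra k A] [IsNoetherianRing A] {m : ℕ}
    (X : Cm A m) (i : ℤ) : ℕ :=
  dimK k (X.obj.homology i)

/-- `i ↦ dim_k H^i(X)` for `X` in `K^b(A-proj)`. -/
def Kb.dimH {A : Type u} [Ring A] [Algebra k A] [IsNoetherianRing A] (X : Kb A) (i : ℤ) : ℕ :=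
  dimK k ((HomotopyCategory.homologyFunctor (FGModuleCat.{u} A) (ComplexShape.up ℤ) i).obj X.obj)

/-- `i ↦ dim_k H^i(X)` for `X` in `D^b(A-mod)`. -/
def Db.dimH {A : Type u} [Ring A] [Algebra k A] [IsNoetherianRing A]
    [HasDerivedCategory.{v} (FGModuleCat.{u} A)] (X : Db.{v} A) (i : ℤ) : ℕ :=
  dimK k ((DerivedCategory.homologyFunctor (FGModuleCat.{u} A) i).obj X.obj)

/-- `C_m(A-proj)` is of strongly unbounded type. -/
def CmStronglyUnbounded (m : ℕ) : Prop :=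
  ∃ r : ℕ → ℕ, StrictMono r ∧ ∀ n, ¬ FinitelyManyUpTo Isomorphic fun X : Cm A m =>
    IsIndecomposable X ∧ cohomologicalRange (Cm.dimH k X) = r n

/-- The algebra `A` is `C`-dichotomic. -/
def IsCDichotomic : Prop :=
  (∀ m : ℕ, 1 ≤ m → CmFinite A m) ∨ ∃ m : ℕ, 1 ≤ m ∧ CmStronglyUnbounded k A m

/-- `K^b(A-proj)` is discrete. -/
def KbDiscrete : Prop :=
  ∀ h : ℤ → ℕ, FinitelyManyUpTo Isomorphic fun X : Kb A => Kb.dimH k X = h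

/-- `K^b(A-proj)` is of strongly unbounded type. -/
def KbStronglyUnbounded : Prop :=
  ∃ r : ℕ → ℕ, StrictMono r ∧ ∀ n, ¬ FinitelyManyUpTo
    (fun X Y : Kb A => IsoUpToShift X.obj Y.obj) fun X : Kb A =>
      IsIndecomposable X ∧ cohomologicalRange (Kb.dimH k X) = r n

variable [HasDerivedCategory.{v} (FGModuleCat.{u} A)]

/-- `A` is derived discrete. -/
def DerivedDiscrete : Prop :=
  ∀ h : ℤ → ℕ, FinitelyManyUpTo Isomorphic fun X : Db.{v} A => Db.dimH k X = h

/-- `A` is strongly derived unbounded. -/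
def StronglyDerivedUnbounded : Prop :=
  ∃ r : ℕ → ℕ, StrictMono r ∧ ∀ n, ¬ FinitelyManyUpTo
    (fun X Y : Db.{v} A => IsoUpToShift X.obj Y.obj) fun X : Db.{v} A =>
      IsIndecomposable X ∧ cohomologicalRange (Db.dimH k X) = r n

end Algebra

end

end DerivedRepType

/-! Both alternatives are transported along C_m(A-proj) → K^b(A-proj) → D^b(A-mod). The second
functor is fully faithful, since bounded complexes of projectives are K-projective. The first is
full, and a null-homotopic endomorphism of a minimal complex has its components in the radical, so
it is nilpotent. Hence the composite preserves indecomposability (idempotents lift modulo a nil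
ideal), reflects isomorphism and keeps cohomology dimensions.

Unbounded case: the cohomology of an object of C_m lies in degrees 0, …, m, so only finitely many
shifts of a given nonzero object can come from C_m. Infinitely many classes in C_m thus stay
infinitely many up to shift (`Cm.finitelyManyUpTo_of_toDb`).

Finite case: after a shift, the objects with a given cohomology vector have cohomology in degrees 1,
…, m. Such an object is τ≥1 of a complex T of projectives in degrees 0, …, m (`exists_iso_truncGE`).
Indecomposable summands of T are contractible or lie in C_m, and the number of those surviving τ≥1
is at most the total cohomology dimension. Finitely many candidates remain (`exists_iso_sumsLE`). -/

namespace DerivedRepType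

/-! ### Fitting's lemma and the radical of a module. -/

section Fitting

variable {R : Type*} [Ring R] {M N : Type*} [AddCommGroup M] [Module R M]
  [AddCommGroup N] [Module R N]

/-- A non-nilpotent endomorphism of a module of finite length has a nonzero partial inverse. -/
theorem exists_mul_mul_eq_self_of_not_isNilpotent [IsNoetherian R M] [IsArtinian R M]
    (φ : Module.End R M) (hφ : ¬ IsNilpotent φ) :
    ∃ ψ : Module.End R M, ψ ≠ 0 ∧ ψ * φ * ψ = ψ := by
  obtain ⟨n, hn⟩ := Filter.eventually_atTop.mp φ.eventually_isCompl_ker_pow_range_pow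
  -- A positive exponent is taken so that ker φ ⊆ ker φ ^ p.
  have h1 := hn (n + 1) (by omega)
  set p := n + 1 with hp
  have hmaps : ∀ x ∈ LinearMap.range (φ ^ p), φ x ∈ LinearMap.range (φ ^ p) := by
    rintro _ ⟨y, rfl⟩
    exact ⟨φ y, by rw [← Module.End.mul_apply, ← Module.End.mul_apply, ← pow_succ, pow_succ']⟩
  let g : LinearMap.range (φ ^ p) →ₗ[R] LinearMap.range (φ ^ p) := φ.restrict hmaps
  have ginj : Function.Injective g := by
    rw [← LinearMap.ker_eq_bot, LinearMap.ker_eq_bot']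
    rintro ⟨x, hx⟩ hgx
    have hφx : φ x = 0 := congrArg Subtype.val hgx
    have : x ∈ LinearMap.ker (φ ^ p) ⊓ LinearMap.range (φ ^ p) := by
      refine Submodule.mem_inf.mpr ⟨?_, hx⟩
      rw [LinearMap.mem_ker, hp, pow_succ, Module.End.mul_apply, hφx, map_zero]
    rw [h1.inf_eq_bot] at this
    exact Subtype.ext this
  let e : LinearMap.range (φ ^ p) ≃ₗ[R] LinearMap.range (φ ^ p) :=
    LinearEquiv.ofBijective g (IsArtinian.bijective_of_injective_endomorphism g ginj)
  let π := (LinearMap.range (φ ^ p)).projectionOnto _ h1.symm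
  let ι := (LinearMap.range (φ ^ p)).subtype
  have hπι : ∀ x, π (ι x) = x := fun x => Submodule.projectionOnto_apply_left h1.symm x
  have hι : ∀ x, φ (ι x) = ι (e x) := fun x => rfl
  refine ⟨ι ∘ₗ e.symm.toLinearMap ∘ₗ π, ?_, ?_⟩
  · intro h0
    apply hφ
    refine ⟨p, LinearMap.ext fun x => ?_⟩
    have := congrArg (fun f : Module.End R M => f (ι (e ⟨(φ ^ p) x, x, rfl⟩))) h0
    simp only [LinearMap.comp_apply, LinearEquiv.coe_coe, hπι, LinearEquiv.symm_apply_apply] at this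
    exact this
  · ext x
    simp only [Module.End.mul_apply, LinearMap.comp_apply, LinearEquiv.coe_coe, hι, hπι,
      LinearEquiv.apply_symm_apply]

/-- A form of Nakayama's lemma. -/
theorem eq_top_of_sup_jacobson_eq_top [Module.Finite R M] {L : Submodule R M}
    (h : L ⊔ Module.jacobson R M = ⊤) : L = ⊤ := by
  rcases eq_top_or_exists_le_coatom L with h' | ⟨K, hK, hLK⟩
  · exact h'
  · exact absurd (top_le_iff.mp (h ▸ sup_le hLK (sInf_le hK))) hK.1

/-- An endomorphism with image in the radical is nilpotent. -/
theorem isNilpotent_of_range_le_jacobson [IsNoetherian R M] [IsArtinian R M]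
    (φ : Module.End R M) (hφ : LinearMap.range φ ≤ Module.jacobson R M) : IsNilpotent φ := by
  by_contra hnil
  obtain ⟨ψ, h0, h⟩ := exists_mul_mul_eq_self_of_not_isNilpotent φ hnil
  have htop : LinearMap.range (1 - φ * ψ) = ⊤ := by
    apply eq_top_of_sup_jacobson_eq_top
    rw [eq_top_iff]
    rintro x -
    have : x = (1 - φ * ψ) x + φ (ψ x) := by simp
    rw [this]
    exact Submodule.add_mem_sup ⟨x, rfl⟩ (hφ ⟨ψ x, rfl⟩)
  -- ψ * (1 - φ * ψ) = 0 and 1 - φ * ψ is onto, so ψ = 0.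
  apply h0
  ext x
  obtain ⟨y, rfl⟩ := LinearMap.range_eq_top.mp htop x
  have := congrArg (fun f : Module.End R M => f y) h
  simp only [Module.End.mul_apply] at this
  simp [this]

/-- A map to a projective module whose image is not contained in the radical has a nonzero
partial inverse. -/
theorem exists_comp_comp_eq_self_of_not_range_le_jacobson [IsNoetherian R N] [IsArtinian R N]
    [Module.Projective R N] (f : M →ₗ[R] N) (hf : ¬ LinearMap.range f ≤ Module.jacobson R N) :
    ∃ w : N →ₗ[R] M, w ≠ 0 ∧ w ∘ₗ f ∘ₗ w = w := by
  obtain ⟨K, hK, hfK⟩ : ∃ K : Submodule R N, IsCoatom K ∧ ¬ LinearMap.range f ≤ K := by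
    by_contra! h
    exact hf (le_sInf fun K hK => h K hK)
  have hsup : LinearMap.range f ⊔ K = ⊤ :=
    hK.2 _ (lt_of_le_of_ne le_sup_right fun h => hfK (le_sup_left.trans h.symm.le))
  -- A section of M × K → N writes the identity as φ plus a map into K. If φ were nilpotent, the
  -- unit 1 - φ would have its image in the proper submodule K.
  obtain ⟨s, hs⟩ := Module.projective_lifting_property (f.coprod K.subtype) LinearMap.id (by
    rw [← LinearMap.range_eq_top, LinearMap.range_coprod, Submodule.range_subtype, hsup])
  let φ : Module.End R N := f ∘ₗ LinearMap.fst R M K ∘ₗ s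
  have hφ : ¬ IsNilpotent φ := by
    intro hnil
    have hu : IsUnit (1 - φ) := hnil.isUnit_one_sub
    apply hK.1
    rw [eq_top_iff]
    rintro x -
    obtain ⟨y, rfl⟩ := ((Module.End.isUnit_iff _).mp hu).2 x
    have h1 : f (s y).1 + ((s y).2 : N) = y := LinearMap.congr_fun hs y
    have h2 : (1 - φ) y = (s y).2 := by
      change y - f (s y).1 = _
      rw [sub_eq_iff_eq_add', h1]
    rw [h2]
    exact (s y).2.2
  obtain ⟨ψ, h0, h⟩ := exists_mul_mul_eq_self_of_not_isNilpotent φ hφ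
  refine ⟨(LinearMap.fst R M K ∘ₗ s) ∘ₗ ψ, ?_, ?_⟩
  · intro hw
    apply h0
    have : φ * ψ = 0 := by
      change f ∘ₗ ((LinearMap.fst R M K ∘ₗ s) ∘ₗ ψ) = 0
      rw [hw, LinearMap.comp_zero]
    rw [← h, mul_assoc, this, mul_zero]
  · change (LinearMap.fst R M K ∘ₗ s) ∘ₗ (ψ * φ * ψ) = _
    rw [h]

end Fitting

/-! ### Homotopy minimal complexes and null-homotopic endomorphisms. -/

section Complexes

variable {A : Type u} [Ring A]

theorem isZero_iff_subsingleton (M : FGModuleCat.{u} A) : IsZero M ↔ Subsingleton M := by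
  rw [IsZero.iff_id_eq_zero]
  constructor
  · intro h
    refine ⟨fun x y => ?_⟩
    have h' : ∀ z : M, z = 0 := fun z =>
      LinearMap.congr_fun (congrArg (fun f : M ⟶ M => f.hom.hom) h) z
    rw [h' x, h' y]
  · intro h
    ext x
    exact Subsingleton.elim (α := M) _ _

theorem isCbProj.of_retract {X Y : CochainComplex (FGModuleCat.{u} A) ℤ} (hX : isCbProj A X)
    (r : Retract Y X) : isCbProj A Y := by
  have hr : ∀ i, r.i.f i ≫ r.r.f i = 𝟙 _ := fun i => by
    rw [← HomologicalComplex.comp_f, r.retract, HomologicalComplex.id_f]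
  obtain ⟨hp, a, b, hab⟩ := hX
  refine ⟨fun i => ?_, a, b, fun i hi => ?_⟩
  · have := hp i
    exact Module.Projective.of_split (r.i.f i).hom.hom (r.r.f i).hom.hom
      (congrArg (fun f => f.hom.hom) (hr i))
  · rw [IsZero.iff_id_eq_zero, ← hr i, (hab i hi).eq_of_tgt (r.i.f i) 0, zero_comp]

/-- Minimality passes to Y because its differential is that of X between the two retraction maps,
and module maps send radical to radical. -/
theorem isCm.of_retract {m : ℕ} {X Y : CochainComplex (FGModuleCat.{u} A) ℤ} (hX : isCm A m X)
    (r : Retract Y X) : isCm A m Y := by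
  have hr : ∀ i, r.i.f i ≫ r.r.f i = 𝟙 _ := fun i => by
    rw [← HomologicalComplex.comp_f, r.retract, HomologicalComplex.id_f]
  obtain ⟨hp, hmin, hab⟩ := hX
  refine ⟨hp.of_retract r, fun i => ?_, fun i hi => ?_⟩
  · have hd : Y.d i (i + 1) = r.i.f i ≫ X.d i (i + 1) ≫ r.r.f (i + 1) := by
      rw [← r.r.comm, reassoc_of% (hr i)]
    rintro _ ⟨x, rfl⟩
    rw [hd]
    exact Module.map_jacobson_le (r.r.f (i + 1)).hom.hom ⟨_, hmin i ⟨_, rfl⟩, rfl⟩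
  · rw [IsZero.iff_id_eq_zero, ← hr i, (hab i hi).eq_of_tgt (r.i.f i) 0, zero_comp]

variable [IsNoetherianRing A]

instance (m : ℕ) : IsIdempotentComplete (Cm A m) where
  idempotents_split X p hp := by
    obtain ⟨Y, i, e, h1, h2⟩ := IsIdempotentComplete.idempotents_split X.obj p.hom
      (congrArg (fun f => f.hom) hp)
    exact ⟨⟨Y, X.property.of_retract ⟨i, e, h1⟩⟩, ObjectProperty.homMk i, ObjectProperty.homMk e,
      ObjectProperty.hom_ext _ h1, ObjectProperty.hom_ext _ h2⟩

variable [IsArtinianRing A]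

/-- A null-homotopic endomorphism of a bounded homotopy minimal complex is nilpotent. -/
theorem IsHomotopyMinimal.isNilpotent_of_homotopy_zero {X : CochainComplex (FGModuleCat.{u} A) ℤ}
    (hX : IsHomotopyMinimal X) {a b : ℤ} (hab : ∀ i, i < a ∨ b < i → IsZero (X.X i))
    (f : End X) (h : Homotopy (C := X) (D := X) f 0) : IsNilpotent f := by
  let φ : ∀ i, Module.End A (X.X i) := fun i => (HomologicalComplex.Hom.f f i).hom.hom
  have hrange : ∀ i, LinearMap.range (φ i) ≤ Module.jacobson A (X.X i) := by
    intro i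
    have hf := h.comm i
    obtain ⟨i, rfl⟩ : ∃ j, i = j + 1 := ⟨i - 1, by simp⟩
    -- f = dh + hd: one summand ends with d, the other applies h to the image of d, so both land in
    -- the radical.
    rw [dNext_eq h.hom (show (ComplexShape.up ℤ).Rel (i + 1) (i + 1 + 1) from rfl),
      prevD_eq h.hom (show (ComplexShape.up ℤ).Rel i (i + 1) from rfl), HomologicalComplex.zero_f,
      add_zero] at hf
    rintro _ ⟨x, rfl⟩
    dsimp only [φ]
    rw [hf]
    refine Submodule.add_mem _ ?_ (hX i ⟨_, rfl⟩)
    exact Module.map_jacobson_le (h.hom (i + 1 + 1) (i + 1)).hom.hom ⟨_, hX (i + 1) ⟨_, rfl⟩, rfl⟩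
  have hpow : ∀ i (n : ℕ) (x : X.X i),
      (HomologicalComplex.Hom.f (f ^ n) i).hom.hom x = (φ i ^ n) x := by
    intro i n
    induction n with
    | zero => intro x; rfl
    | succ n ih => intro x; rw [pow_succ, pow_succ, Module.End.mul_apply, ← ih]; rfl
  have hnil : ∀ i, ∃ n : ℕ, φ i ^ n = 0 := fun i =>
    isNilpotent_of_range_le_jacobson (φ i) (hrange i)
  choose n hn using hnil
  refine ⟨∑ i ∈ Finset.Icc a b, n i, ?_⟩
  refine HomologicalComplex.hom_ext _ _ fun i => FGModuleCat.hom_ext (LinearMap.ext fun x => ?_)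
  by_cases hi : i ∈ Finset.Icc a b
  · rw [hpow, pow_eq_zero_of_le (Finset.single_le_sum (fun _ _ => Nat.zero_le _) hi) (hn i)]
    rfl
  · have := (isZero_iff_subsingleton (X.X i)).mp (hab i (by simp at hi; omega))
    exact Subsingleton.elim (α := X.X i) _ _

/-- A complex of projective modules which is not homotopy minimal has a nonzero null-homotopic
idempotent. -/
theorem exists_homotopy_zero_of_not_isHomotopyMinimal {X : CochainComplex (FGModuleCat.{u} A) ℤ}
    (hproj : ∀ i, Module.Projective A (X.X i)) (hX : ¬ IsHomotopyMinimal X) :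
    ∃ e : X ⟶ X, e ≠ 0 ∧ e ≫ e = e ∧ Nonempty (Homotopy e 0) := by
  obtain ⟨i, hi⟩ := not_forall.mp hX
  obtain ⟨w', hw0, hw'⟩ := exists_comp_comp_eq_self_of_not_range_le_jacobson _ hi
  let w : X.X (i + 1) ⟶ X.X i := FGModuleCat.ofHom w'
  have hw : w ≫ X.d i (i + 1) ≫ w = w := by
    ext x
    exact LinearMap.congr_fun hw' x
  -- The homotopy has w as its only component. The resulting map is d ≫ w in degree i, w ≫ d in
  -- degree i + 1 and zero elsewhere; w ≫ d ≫ w = w makes it idempotent.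
  let h : ∀ p q : ℤ, (ComplexShape.up ℤ).Rel q p → (X.X p ⟶ X.X q) := fun p q hpq =>
    if hq : q = i then (X.XIsoOfEq (by rw [← hpq, hq])).hom ≫ w ≫ (X.XIsoOfEq hq.symm).hom else 0
  have hh : h (i + 1) i rfl = w := by simp [h]
  have hh' : ∀ p q hpq, q ≠ i → h p q hpq = 0 := fun p q hpq hq => by simp [h, hq]
  have hf : ∀ j, (Homotopy.nullHomotopicMap' h).f (j + 1) =
    X.d (j + 1) (j + 1 + 1) ≫ h _ _ rfl + h _ _ rfl ≫ X.d j (j + 1) := fun j =>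
    Homotopy.nullHomotopicMap'_f (c := ComplexShape.up ℤ) rfl rfl h
  have hfi : (Homotopy.nullHomotopicMap' h).f i = X.d i (i + 1) ≫ w := by
    obtain ⟨j, rfl⟩ : ∃ j, i = j + 1 := ⟨i - 1, by simp⟩
    rw [hf, hh, hh' _ j rfl (by simp), zero_comp, add_zero]
  refine ⟨Homotopy.nullHomotopicMap' h, ?_, ?_, ⟨Homotopy.nullHomotopy' h⟩⟩
  · intro h0
    rw [h0, HomologicalComplex.zero_f] at hfi
    rw [← hfi, comp_zero] at hw
    exact hw0 (congrArg (fun f => f.hom.hom) hw.symm)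
  · ext j : 1
    rw [HomologicalComplex.comp_f]
    by_cases hj : j = i
    · subst hj
      rw [hfi, Category.assoc, hw]
    · obtain ⟨j, rfl⟩ : ∃ l, j = l + 1 := ⟨j - 1, by simp⟩
      rw [hf, hh' _ (j + 1) rfl hj, comp_zero, zero_add]
      by_cases hj' : j = i
      · subst hj'
        rw [hh, Category.assoc, reassoc_of% hw]
      · rw [hh' _ j rfl hj', zero_comp, comp_zero]

end Complexes

/-! ### Indecomposability through idempotents; full functors with nil kernel. -/

section Idempotents

variable {C : Type*} [Category* C] [Preadditive C] {D : Type*} [Category* D] [Preadditive D]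

/-- An idempotent endomorphism and its complement give a direct sum decomposition. -/
theorem exists_binaryBicone_of_idempotent [IsIdempotentComplete C] {X : C} (e : X ⟶ X)
    (he : e ≫ e = e) : ∃ (Y Z : C) (b : BinaryBicone Y Z) (φ : X ≅ b.pt), Nonempty b.IsBilimit ∧
      e = φ.hom ≫ b.fst ≫ b.inl ≫ φ.inv := by
  obtain ⟨Y, i, p, hip, hpi⟩ := IsIdempotentComplete.idempotents_split X e he
  obtain ⟨Z, j, q, hjq, hqj⟩ := IsIdempotentComplete.idempotents_split X (𝟙 X - e) (by simp [he])
  have hi : i ≫ e = i := by rw [← hpi, reassoc_of% hip]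
  have hp : e ≫ p = p := by rw [← hpi, Category.assoc, hip, Category.comp_id]
  have hiq : i ≫ q = 0 := by
    have : i ≫ (q ≫ j) ≫ q = i ≫ q := by simp [hjq]
    rw [← this, hqj]
    simp [reassoc_of% hi]
  have hjp : j ≫ p = 0 := by
    have : j ≫ (q ≫ j) ≫ p = j ≫ p := by simp [reassoc_of% hjq]
    rw [← this, hqj]
    simp [hp]
  refine ⟨Y, Z, ⟨X, p, q, i, j, hip, hiq, hjp, hjq⟩, Iso.refl X, ⟨isBinaryBilimitOfTotal _ ?_⟩, ?_⟩
  · simp [hpi, hqj]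
  · simp [hpi]

theorem isIndecomposable_of_idempotents (X : C) (h0 : ¬ IsZero X)
    (h : ∀ e : X ⟶ X, e ≫ e = e → e = 0 ∨ e = 𝟙 X) : IsIndecomposable X := by
  refine ⟨h0, fun Y Z b _ ⟨φ⟩ => ?_⟩
  rcases h (φ.hom ≫ b.fst ≫ b.inl ≫ φ.inv) (by simp) with he | he
  · left
    rw [IsZero.iff_id_eq_zero]
    have : b.inl ≫ φ.inv ≫ (φ.hom ≫ b.fst ≫ b.inl ≫ φ.inv) ≫ φ.hom ≫ b.fst = 𝟙 Y := by simp
    rw [← this, he]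
    simp
  · right
    rw [IsZero.iff_id_eq_zero]
    have : b.inr ≫ φ.inv ≫ (φ.hom ≫ b.fst ≫ b.inl ≫ φ.inv) ≫ φ.hom ≫ b.snd = 0 := by simp
    rw [he] at this
    simpa using this

theorem IsIndecomposable.eq_zero_or_eq_id [IsIdempotentComplete C] {X : C}
    (h : IsIndecomposable X) (e : X ⟶ X) (he : e ≫ e = e) : e = 0 ∨ e = 𝟙 X := by
  obtain ⟨Y, Z, b, φ, ⟨hb⟩, rfl⟩ := exists_binaryBicone_of_idempotent e he
  rcases h.2 Y Z b ⟨hb⟩ ⟨φ⟩ with h0 | h0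
  · left
    simp [h0.eq_of_src b.inl 0]
  · right
    have : b.fst ≫ b.inl = 𝟙 _ := by
      simpa [h0.eq_of_src b.inr 0] using IsBilimit.binary_total hb
    simp [reassoc_of% this]

/-- A full functor which sends only nilpotent endomorphisms to zero preserves indecomposable
objects. -/
theorem IsIndecomposable.map [IsIdempotentComplete C] (F : C ⥤ D) [F.Full] [F.Additive] {X : C}
    (hF : ∀ f : End X, F.map f = 0 → IsNilpotent f) (hX : IsIndecomposable X) :
    IsIndecomposable (F.obj X) := by
  refine isIndecomposable_of_idempotents _ (fun h0 => hX.1 ?_) fun e he => ?_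
  · obtain ⟨n, hn⟩ := hF 1 (h0.eq_of_src _ _)
    rw [one_pow] at hn
    exact (IsZero.iff_id_eq_zero X).mpr hn
  · let G : End X →+* End (F.obj X) :=
      { F.mapEnd X with
        map_zero' := F.map_zero X X
        map_add' := fun f g => F.map_add }
    obtain ⟨e', he', rfl⟩ := exists_isIdempotentElem_eq_of_ker_isNilpotent G
      (fun x hx => hF x hx) e (F.map_surjective e) he
    rcases hX.eq_zero_or_eq_id e' he' with h | h
    · left
      rw [h]
      exact F.map_zero X X
    · right
      rw [h]
      exact F.map_id X

/-- A full functor which sends only nilpotent endomorphisms of two objects to zero reflects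
isomorphisms between them. -/
theorem nonempty_iso_of_map_iso (F : C ⥤ D) [F.Full] [F.Additive] {X Y : C}
    (hX : ∀ f : End X, F.map f = 0 → IsNilpotent f) (hY : ∀ f : End Y, F.map f = 0 → IsNilpotent f)
    (h : Nonempty (F.obj X ≅ F.obj Y)) : Nonempty (X ≅ Y) := by
  obtain ⟨φ⟩ := h
  obtain ⟨f, hf⟩ := F.map_surjective φ.hom
  obtain ⟨g, hg⟩ := F.map_surjective φ.inv
  -- An endomorphism mapped to the identity differs from 1 by a nilpotent, hence is invertible. This
  -- applies to both composites of the lifts f and g.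
  have key : ∀ {Z : C} (_ : ∀ f : End Z, F.map f = 0 → IsNilpotent f) (a : End Z),
      F.map a = 𝟙 _ → IsIso (X := Z) (Y := Z) a := fun {Z} hZ a ha => by
    have hu : IsUnit a := by
      have := (hZ (1 - a) (by
        change F.map (𝟙 Z - (show Z ⟶ Z from a)) = 0
        rw [F.map_sub, ha, F.map_id, sub_self])).isUnit_one_sub
      rwa [sub_sub_cancel] at this
    exact (isUnit_iff_isIso a).mp hu
  have h1 : IsIso (f ≫ g) := key hX (f ≫ g) (by rw [F.map_comp, hf, hg, φ.hom_inv_id])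
  have h2 : IsIso (g ≫ f) := key hY (g ≫ f) (by rw [F.map_comp, hf, hg, φ.inv_hom_id])
  have : IsSplitMono f := ⟨⟨⟨g ≫ inv (f ≫ g), by rw [← Category.assoc, IsIso.hom_inv_id]⟩⟩⟩
  have : Epi f := epi_of_epi g f
  exact ⟨@asIso _ _ _ _ f (isIso_of_epi_of_isSplitMono f)⟩

end Idempotents

/-! ### The functors C_m(A-proj) → K^b(A-proj) → D^b(A-mod). -/

section Functors

variable {A : Type u} [Ring A]

theorem projective_of_module_projective [IsNoetherianRing A] (M : FGModuleCat.{u} A)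
    [Module.Projective A M] : Projective M where
  factors {E X} f e he := by
    have : Epi e.hom := inferInstanceAs (Epi ((forget₂ (FGModuleCat A) (ModuleCat A)).map e))
    have : Projective M.obj := (IsProjective.iff_projective M.obj).mp ‹_›
    exact ⟨ObjectProperty.homMk (Projective.factorThru f.hom e.hom),
      ObjectProperty.hom_ext _ (Projective.factorThru_comp f.hom e.hom)⟩

/-- The source of the full faithfulness of `Kb.toDb`. -/
theorem isCbProj.isKProjective [IsNoetherianRing A] {X : CochainComplex (FGModuleCat.{u} A) ℤ}
    (hX : isCbProj A X) : X.IsKProjective := by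
  obtain ⟨hp, a, b, hab⟩ := hX
  have : ∀ i, Projective (X.X i) := fun i => have := hp i; projective_of_module_projective _
  have : X.IsStrictlyLE b := by
    rw [CochainComplex.isStrictlyLE_iff]
    exact fun i hi => hab i (Or.inr hi)
  exact CochainComplex.isKProjective_of_projective X b

variable (A) in
/-- The functor from `C_m(A-proj)` to `K^b(A-proj)`. -/
noncomputable abbrev Cm.toKb (m : ℕ) : Cm A m ⥤ Kb A :=
  (isKbProj A).lift ((isCm A m).ι ⋙ HomotopyCategory.quotient _ _) fun X => X.property.1

instance (m : ℕ) : (Cm.toKb A m).Full where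
  map_surjective f := by
    obtain ⟨g, hg⟩ := (HomotopyCategory.quotient _ _).map_surjective f.hom
    exact ⟨ObjectProperty.homMk g, ObjectProperty.hom_ext _ hg⟩

instance (m : ℕ) : (Cm.toKb A m).Additive where
  map_add := rfl

variable [IsNoetherianRing A] [HasDerivedCategory.{v} (FGModuleCat.{u} A)]

theorem isCbProj.bounded_Q_obj {X : CochainComplex (FGModuleCat.{u} A) ℤ} (hX : isCbProj A X) :
    DerivedCategory.TStructure.t.bounded (DerivedCategory.Q.obj X) := by
  obtain ⟨-, a, b, hab⟩ := hX
  have hle : X.IsStrictlyLE b := by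
    rw [CochainComplex.isStrictlyLE_iff]
    exact fun i hi => hab i (Or.inr hi)
  have hge : X.IsStrictlyGE a := by
    rw [CochainComplex.isStrictlyGE_iff]
    exact fun i hi => hab i (Or.inl hi)
  exact ⟨⟨a, inferInstanceAs ((DerivedCategory.Q.obj X).IsGE a)⟩,
    ⟨b, inferInstanceAs ((DerivedCategory.Q.obj X).IsLE b)⟩⟩

theorem isKbProj.bounded_Qh_obj {X : HomotopyCategory (FGModuleCat.{u} A) (ComplexShape.up ℤ)}
    (hX : isKbProj A X) : DerivedCategory.TStructure.t.bounded (DerivedCategory.Qh.obj X) :=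
  ObjectProperty.prop_of_iso _ ((DerivedCategory.quotientCompQhIso _).symm.app X.as)
    (isCbProj.bounded_Q_obj hX)

variable (A) in
/-- The functor from `K^b(A-proj)` to `D^b(A-mod)`. -/
noncomputable abbrev Kb.toDb : Kb A ⥤ Db.{v} A :=
  ObjectProperty.lift _ ((isKbProj A).ι ⋙ DerivedCategory.Qh) fun X => X.property.bounded_Qh_obj

theorem Kb.Qh_map_bijective (X Y : Kb A) :
    Function.Bijective (DerivedCategory.Qh.map : (X.obj ⟶ Y.obj) → _) :=
  have := X.property.isKProjective
  CochainComplex.IsKProjective.Qh_map_bijective X.obj.as Y.obj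

instance : (Kb.toDb.{v} A).Full where
  map_surjective {X Y} f := by
    obtain ⟨g, hg⟩ := (Kb.Qh_map_bijective X Y).2 f.hom
    exact ⟨ObjectProperty.homMk g, ObjectProperty.hom_ext _ hg⟩

instance : (Kb.toDb.{v} A).Faithful where
  map_injective {X Y} _ _ h := ObjectProperty.hom_ext _ ((Kb.Qh_map_bijective X Y).1
    (congrArg (fun a => a.hom) h))

instance : (Kb.toDb.{v} A).Additive where
  map_add := ObjectProperty.hom_ext _ DerivedCategory.Qh.map_add

end Functors

/-! ### Dimensions over k and their invariance under the functors. -/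

section Dimension

variable (k : Type w) [Field k] {A : Type u} [Ring A] [Algebra k A]

theorem dimK_eq_of_iso {M N : FGModuleCat.{u} A} (e : M ≅ N) : dimK k M = dimK k N :=
  (((forget₂ _ (ModuleCat A)) ⋙ ModuleCat.restrictScalars (algebraMap k A)).mapIso
    e).toLinearEquiv.finrank_eq

variable [Module.Finite k A]

theorem finite_restrictScalars (M : FGModuleCat.{u} A) :
    Module.Finite k ((ModuleCat.restrictScalars (algebraMap k A)).obj M.obj) := by
  let : Module k M := Module.compHom M (algebraMap k A)
  have : IsScalarTower k A M := ⟨fun x a m => by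
    rw [Algebra.smul_def, mul_smul]; rfl⟩
  exact Module.Finite.trans (R := k) A M

theorem dimK_eq_zero_iff (M : FGModuleCat.{u} A) : dimK k M = 0 ↔ IsZero M := by
  have := finite_restrictScalars k M
  rw [isZero_iff_subsingleton]
  exact Module.finrank_zero_iff (R := k)

theorem dimK_biprod [IsNoetherianRing A] (M N : FGModuleCat.{u} A) :
    dimK k (M ⊞ N) = dimK k M + dimK k N := by
  let F : FGModuleCat.{u} A ⥤ ModuleCat.{u} k :=
    forget₂ (FGModuleCat A) (ModuleCat A) ⋙ ModuleCat.restrictScalars (algebraMap k A)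
  have hF : F.Additive := ⟨rfl⟩
  have := preservesBinaryBiproducts_of_preservesBiproducts F
  have : Module.Finite k (F.obj M) := finite_restrictScalars k M
  have : Module.Finite k (F.obj N) := finite_restrictScalars k N
  let e := (F.mapBiprod M N ≪≫ ModuleCat.biprodIsoProd _ _).toLinearEquiv
  exact e.finrank_eq.trans (Module.finrank_prod (R := k))

end Dimension

section CohomologyDimension

variable (k : Type w) [Field k] {A : Type u} [Ring A] [Algebra k A] [IsNoetherianRing A]

theorem Cm.dimH_toKb_obj {m : ℕ} (X : Cm A m) :
    Kb.dimH k ((Cm.toKb A m).obj X) = Cm.dimH k X :=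
  funext fun i => dimK_eq_of_iso k
    ((HomotopyCategory.homologyFunctorFactors _ (ComplexShape.up ℤ) i).app X.obj)

theorem Kb.dimH_toDb_obj [HasDerivedCategory.{v} (FGModuleCat.{u} A)] (X : Kb A) :
    Db.dimH k ((Kb.toDb.{v} A).obj X) = Kb.dimH k X :=
  funext fun i => dimK_eq_of_iso k
    ((DerivedCategory.homologyFunctorFactorsh (FGModuleCat A) i).app X.obj)

end CohomologyDimension

/-- A property is finite up to a relation `r` if its objects are covered by finitely many indices,
and objects with a common index are related by `r`. -/
theorem finitelyManyUpTo_of_cover {C : Type u} [Category.{v} C] {ι : Type*} {r : C → C → Prop}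
    {P : C → Prop}
    (R : C → ι → Prop) (t : Set ι) (ht : t.Finite) (hR : ∀ X, P X → ∃ i ∈ t, R X i)
    (hr : ∀ X Y i, P X → P Y → R X i → R Y i → r X Y) : FinitelyManyUpTo r P := by
  classical
  -- Indices that no object uses are dropped, so each remaining one has a representative.
  let t' : Set ι := {i ∈ t | ∃ X, P X ∧ R X i}
  have ht' : t'.Finite := ht.subset fun i hi => hi.1
  have := ht'.to_subtype
  choose f hf using fun i : t' => i.2.2
  refine ⟨Set.range f, Set.finite_range f, fun X hX => ?_⟩
  obtain ⟨i, hi, hXi⟩ := hR X hX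
  exact ⟨_, ⟨⟨i, hi, X, hX, hXi⟩, rfl⟩, hr _ _ i hX (hf _).1 hXi (hf _).2⟩

/-! ### Transfer of strong unboundedness. -/

section Unbounded

/-- Such an object is both ≤ 0 and ≥ 1 for the t-structure. -/
theorem isZero_of_isZero_homology {C : Type u} [Category.{w} C] [Abelian C]
    [HasDerivedCategory.{v} C] (X : DerivedCategory C)
    (h : ∀ i, IsZero ((DerivedCategory.homologyFunctor C i).obj X)) : IsZero X := by
  have : X.IsLE 0 := (X.isLE_iff 0).mpr fun i _ => h i
  have : X.IsGE 1 := (X.isGE_iff 1).mpr fun i _ => h i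
  exact DerivedCategory.TStructure.t.isZero X 0 1

variable {A : Type u} [Ring A] [IsNoetherianRing A]

theorem Cm.isZero_homology_toDb_obj [HasDerivedCategory.{v} (FGModuleCat.{u} A)] {m : ℕ}
    (X : Cm A m) (i : ℤ) (hi : i < 0 ∨ (m : ℤ) < i) :
    IsZero ((DerivedCategory.homologyFunctor _ i).obj
      ((Cm.toKb A m ⋙ Kb.toDb.{v} A).obj X).obj) := by
  refine IsZero.of_iso ?_ ((DerivedCategory.homologyFunctorFactorsh _ i).app _ ≪≫
    (HomotopyCategory.homologyFunctorFactors _ (ComplexShape.up ℤ) i).app X.obj)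
  exact ShortComplex.isZero_homology_of_isZero_X₂ _ (X.property.2.2 i hi)

variable [IsArtinianRing A]

theorem Cm.isNilpotent_of_toKb_map_eq_zero {m : ℕ} {X : Cm A m} (f : End X)
    (hf : (Cm.toKb A m).map f = 0) : IsNilpotent f := by
  have h : (HomotopyCategory.quotient _ _).map f.hom = 0 :=
    congrArg (fun a => a.hom) hf
  obtain ⟨n, hn⟩ := X.property.2.1.isNilpotent_of_homotopy_zero X.property.2.2 f.hom
    (HomotopyCategory.homotopyOfEq _ _ (h.trans (Functor.map_zero _ _ _).symm))
  refine ⟨n, ObjectProperty.hom_ext _ (Eq.trans ?_ hn)⟩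
  clear hn
  induction n with
  | zero => rfl
  | succ n ih => rw [pow_succ, pow_succ, ← ih]; rfl

variable [HasDerivedCategory.{v} (FGModuleCat.{u} A)]

theorem Cm.isNilpotent_of_toDb_map_eq_zero {m : ℕ} {X : Cm A m} (f : End X)
    (hf : (Cm.toKb A m ⋙ Kb.toDb.{v} A).map f = 0) : IsNilpotent f :=
  Cm.isNilpotent_of_toKb_map_eq_zero f ((Kb.toDb A).map_injective (by simpa using hf))

/-- If the images in `D^b(A-mod)` of some nonzero objects of `C_m(A-proj)` are covered by the
shifts of finitely many objects, then these objects are finitely many up to isomorphism. -/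
theorem Cm.finitelyManyUpTo_of_toDb {m : ℕ} {P : Cm A m → Prop} (hP : ∀ X, P X → ¬ IsZero X)
    (s : Set (DerivedCategory (FGModuleCat.{u} A))) (hs : s.Finite)
    (hcov : ∀ X, P X → ∃ Y ∈ s, ∃ n : ℤ,
      Nonempty (((Cm.toKb A m ⋙ Kb.toDb.{v} A).obj X).obj ≅ Y⟦n⟧)) :
    FinitelyManyUpTo Isomorphic P := by
  classical
  let H := fun i => DerivedCategory.homologyFunctor (FGModuleCat.{u} A) i
  -- If X ≅ Y⟦n⟧ and H^j(Y) ≠ 0, then H^(j-n)(X) ≠ 0, so 0 ≤ j - n ≤ m. This leaves finitely many n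
  -- for each Y.
  have hdeg : ∀ Y : DerivedCategory (FGModuleCat.{u} A), ∃ j : ℤ,
      ¬ IsZero Y → ¬ IsZero ((H j).obj Y) := fun Y => by
    by_cases hY : IsZero Y
    · exact ⟨0, fun h => absurd hY h⟩
    · by_contra! h
      exact hY (isZero_of_isZero_homology Y fun j => (h j).2)
  choose j hj using hdeg
  refine finitelyManyUpTo_of_cover (ι := DerivedCategory (FGModuleCat.{u} A) × ℤ)
    (fun X p => Nonempty (((Cm.toKb A m ⋙ Kb.toDb.{v} A).obj X).obj ≅ p.1⟦p.2⟧))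
    (⋃ Y ∈ s, (fun n => (Y, n)) '' Set.Icc (j Y - m) (j Y))
    (hs.biUnion fun Y _ => (Set.finite_Icc _ _).image _) ?_ ?_
  · intro X hX
    obtain ⟨Y, hY, n, ⟨e⟩⟩ := hcov X hX
    refine ⟨(Y, n), ?_, ⟨e⟩⟩
    simp only [Set.mem_iUnion]
    refine ⟨Y, hY, n, ?_, rfl⟩
    have hXH : ¬ IsZero ((H (j Y - n)).obj ((Cm.toKb A m ⋙ Kb.toDb.{v} A).obj X).obj) := by
      intro h0
      refine hj Y (fun hY0 => hP X hX ?_) (h0.of_iso ?_)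
      · have h1 : IsZero ((Cm.toKb A m ⋙ Kb.toDb.{v} A).obj X).obj :=
          ((shiftFunctor _ n).map_isZero hY0).of_iso e
        have h2 : (Cm.toKb A m ⋙ Kb.toDb.{v} A).map (𝟙 X) = 0 :=
          ObjectProperty.hom_ext _ (h1.eq_of_src _ _)
        obtain ⟨p, hp⟩ := Cm.isNilpotent_of_toDb_map_eq_zero (1 : End X) h2
        rw [one_pow] at hp
        exact (IsZero.iff_id_eq_zero X).mpr hp
      · exact (((DerivedCategory.homologyFunctor (FGModuleCat.{u} A) 0).shiftIso n (j Y - n) (j Y)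
          (by simp)).app Y).symm ≪≫ (H (j Y - n)).mapIso e.symm
    have := mt (Cm.isZero_homology_toDb_obj X (j Y - n)) hXH
    rw [Set.mem_Icc]
    omega
  · rintro X X' p - - ⟨e⟩ ⟨e'⟩
    exact nonempty_iso_of_map_iso (Cm.toKb A m ⋙ Kb.toDb.{v} A) Cm.isNilpotent_of_toDb_map_eq_zero
      Cm.isNilpotent_of_toDb_map_eq_zero ⟨ObjectProperty.isoMk _ (e ≪≫ e'.symm)⟩

variable (k : Type w) [Field k] [Algebra k A]

theorem stronglyDerivedUnbounded_of_cm {m : ℕ} (h : CmStronglyUnbounded k A m) :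
    StronglyDerivedUnbounded.{v} k A := by
  obtain ⟨r, hr, hfin⟩ := h
  refine ⟨r, hr, fun n ⟨s, hs, hcov⟩ => hfin n ?_⟩
  refine Cm.finitelyManyUpTo_of_toDb.{v} (fun X hX => hX.1.1) _ (hs.image fun Y => Y.obj) ?_
  intro X hX
  obtain ⟨Y, hY, n, e⟩ := hcov ((Cm.toKb A m ⋙ Kb.toDb.{v} A).obj X)
    ⟨hX.1.map _ Cm.isNilpotent_of_toDb_map_eq_zero, by
      rw [← hX.2, Functor.comp_obj, Kb.dimH_toDb_obj, Cm.dimH_toKb_obj]⟩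
  exact ⟨Y.obj, ⟨Y, hY, rfl⟩, n, e⟩

end Unbounded

section KbUnbounded

variable (k : Type w) [Field k] {A : Type u} [Ring A] [Algebra k A] [IsNoetherianRing A]
  [IsArtinianRing A]

/-- Isomorphisms up to shift are pushed to an auxiliary derived category, where the finiteness of
shifts is already known. -/
theorem kbStronglyUnbounded_of_cm {m : ℕ} (h : CmStronglyUnbounded k A m) :
    KbStronglyUnbounded k A := by
  let := HasDerivedCategory.standard (FGModuleCat.{u} A)
  obtain ⟨r, hr, hfin⟩ := h
  refine ⟨r, hr, fun n ⟨s, hs, hcov⟩ => hfin n ?_⟩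
  refine Cm.finitelyManyUpTo_of_toDb (fun X hX => hX.1.1) _
    (hs.image fun Y => DerivedCategory.Qh.obj Y.obj) ?_
  intro X hX
  obtain ⟨Y, hY, n, ⟨e⟩⟩ := hcov ((Cm.toKb A m).obj X)
    ⟨hX.1.map _ Cm.isNilpotent_of_toKb_map_eq_zero, by rw [← hX.2, Cm.dimH_toKb_obj]⟩
  exact ⟨_, ⟨Y, hY, rfl⟩, n, ⟨DerivedCategory.Qh.mapIso e ≪≫
    (DerivedCategory.Qh.commShiftIso n).app Y.obj⟩⟩

end KbUnbounded

/-! ### Approximation by bounded complexes of projectives. -/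

section ProjectivePresentation

open Pretriangulated Triangulated DerivedCategory ZeroObject

theorem epi_of_comm_iso {C : Type*} [Category* C] {X Y X' Y' : C} {f : X ⟶ Y} {g : X' ⟶ Y'}
    (α : X ≅ X') (β : Y ≅ Y') (h : f ≫ β.hom = α.hom ≫ g) (_ : Epi g) : Epi f := by
  have : f = α.hom ≫ g ≫ β.inv := by rw [← reassoc_of% h, Iso.hom_inv_id, Category.comp_id]
  rw [this]
  infer_instance

/-- Exhibits each term of the cocone as a retract of Xⁱ ⊕ Yⁱ, which is enough to inherit
projectivity and vanishing. -/
theorem exists_biprod_data_mappingCocone {C : Type*} [Category* C] [Preadditive C]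
    {X Y : CochainComplex C ℤ} (g : X ⟶ Y⟦(1 : ℤ)⟧) [HomologicalComplex.HasHomotopyCofiber g]
    (i : ℤ) :
    ∃ (i₁ : X.X i ⟶ (CochainComplex.mappingCocone g).X i)
      (p₁ : (CochainComplex.mappingCocone g).X i ⟶ X.X i)
      (i₂ : Y.X i ⟶ (CochainComplex.mappingCocone g).X i)
      (p₂ : (CochainComplex.mappingCocone g).X i ⟶ Y.X i),
      p₁ ≫ i₁ + p₂ ≫ i₂ = 𝟙 _ := by
  have h := CochainComplex.mappingCocone.id_X g i (i - 1) (by omega)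
  let e : (Y⟦(1 : ℤ)⟧).X (i - 1) ≅ Y.X i :=
    CochainComplex.shiftFunctorObjXIso Y 1 (i - 1) i (by omega)
  refine ⟨(CochainComplex.mappingCocone.inl g).v i i (add_zero i),
    (CochainComplex.mappingCocone.fst g).f i,
    e.inv ≫ (CochainComplex.mappingCocone.inr g).1.v (i - 1) i (by omega),
    (CochainComplex.mappingCocone.snd g).v i (i - 1) (by omega) ≫ e.hom, ?_⟩
  rw [Category.assoc, Iso.hom_inv_id_assoc]
  exact h

variable {A : Type u} [Ring A]

variable (A) in
/-- The complexes of finitely generated projective modules which are concentrated in the degrees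
`a + 1, …, b`. -/
def isProjIoc (a b : ℤ) : ObjectProperty (CochainComplex (FGModuleCat.{u} A) ℤ) := fun X =>
  (∀ i, Module.Projective A (X.X i)) ∧ ∀ i, i ≤ a ∨ b < i → IsZero (X.X i)

theorem isProjIoc.mono {a b a' b' : ℤ} {X : CochainComplex (FGModuleCat.{u} A) ℤ}
    (hX : isProjIoc A a b X) (ha : a' ≤ a) (hb : b ≤ b') : isProjIoc A a' b' X :=
  ⟨hX.1, fun i hi => hX.2 i (by omega)⟩

theorem isProjIoc.isCbProj {a b : ℤ} {X : CochainComplex (FGModuleCat.{u} A) ℤ}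
    (hX : isProjIoc A a b X) : isCbProj A X :=
  ⟨hX.1, a, b, fun i hi => hX.2 i (by omega)⟩

variable [IsNoetherianRing A]

theorem isProjIoc.mappingCocone {a b : ℤ} {X Y : CochainComplex (FGModuleCat.{u} A) ℤ}
    (hX : isProjIoc A a b X) (hY : isProjIoc A a b Y) (g : X ⟶ Y⟦(1 : ℤ)⟧) :
    isProjIoc A a b (CochainComplex.mappingCocone g) := by
  refine ⟨fun i => ?_, fun i hi => ?_⟩
  · obtain ⟨i₁, p₁, i₂, p₂, h⟩ := exists_biprod_data_mappingCocone g i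
    have := hX.1 i
    have := hY.1 i
    refine Module.Projective.of_split (M := X.X i × Y.X i) (p₁.hom.hom.prod p₂.hom.hom)
      (i₁.hom.hom.coprod i₂.hom.hom) ?_
    ext x
    exact LinearMap.congr_fun (congrArg (fun f => f.hom.hom) h) x
  · obtain ⟨i₁, p₁, i₂, p₂, h⟩ := exists_biprod_data_mappingCocone g i
    rw [IsZero.iff_id_eq_zero, ← h, (hX.2 i hi).eq_of_src i₁ 0, (hY.2 i hi).eq_of_src i₂ 0]
    simp

theorem exists_projective_epi (M : FGModuleCat.{u} A) :
    ∃ (P : FGModuleCat.{u} A) (f : P ⟶ M), Module.Projective A P ∧ Epi f := by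
  obtain ⟨n, f, hf⟩ := Module.Finite.exists_fin' A M
  refine ⟨FGModuleCat.of A (Fin n → A), ObjectProperty.homMk (ModuleCat.ofHom f),
    inferInstanceAs (Module.Projective A (Fin n → A)), ?_⟩
  apply (forget₂ (FGModuleCat A) (ModuleCat A)).epi_of_epi_map
  exact (ModuleCat.epi_iff_surjective _).mpr hf

theorem isProjIoc_single (b : ℤ) (P : FGModuleCat.{u} A) [Module.Projective A P] :
    isProjIoc A (b - 1) b ((HomologicalComplex.single _ (ComplexShape.up ℤ) b).obj P) := by
  have h0 : ∀ i, i ≠ b →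
      IsZero (((HomologicalComplex.single _ (ComplexShape.up ℤ) b).obj P).X i) := fun i hi =>
    HomologicalComplex.isZero_single_obj_X _ _ _ _ hi
  refine ⟨fun i => ?_, fun i hi => h0 i (by omega)⟩
  by_cases hi : i = b
  · subst hi
    exact Module.Projective.of_equiv (FGModuleCat.isoToLinearEquiv
      (HomologicalComplex.singleObjXSelf (ComplexShape.up ℤ) i P)).symm
  · have := (isZero_iff_subsingleton _).mp (h0 i hi)
    infer_instance

variable [HasDerivedCategory.{v} (FGModuleCat.{u} A)]

variable (A) in
/-- The objects of the derived category which are represented by complexes in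
`isProjIoc A a b`. -/
def isQProjIoc (a b : ℤ) : ObjectProperty (DerivedCategory (FGModuleCat.{u} A)) := fun X =>
  ∃ T, isProjIoc A a b T ∧ Nonempty (X ≅ Q.obj T)

theorem isCbProj.Q_map_surjective {X Y : CochainComplex (FGModuleCat.{u} A) ℤ}
    (hX : isCbProj A X) (f : Q.obj X ⟶ Q.obj Y) : ∃ g : X ⟶ Y, Q.map g = f := by
  have := hX.isKProjective
  obtain ⟨g, hg⟩ := (CochainComplex.IsKProjective.Qh_map_bijective X _).2
    ((quotientCompQhIso _).hom.app X ≫ f ≫ (quotientCompQhIso _).inv.app Y)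
  obtain ⟨g, rfl⟩ := (HomotopyCategory.quotient _ _).map_surjective g
  refine ⟨g, ?_⟩
  rw [← cancel_epi ((quotientCompQhIso _).hom.app X), ← quotientCompQhIso_hom_naturality, hg]
  simp

/-- The objects represented by complexes of projective modules in given degrees are closed under
extensions. -/
theorem isQProjIoc.ext {a b : ℤ} (T : Triangle (DerivedCategory (FGModuleCat.{u} A)))
    (hT : T ∈ distTriang _) (h₁ : isQProjIoc A a b T.obj₁) (h₃ : isQProjIoc A a b T.obj₃) :
    isQProjIoc A a b T.obj₂ := by
  obtain ⟨X, hX, ⟨eX⟩⟩ := h₁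
  obtain ⟨Y, hY, ⟨eY⟩⟩ := h₃
  let e : T.obj₁⟦(1 : ℤ)⟧ ≅ Q.obj (X⟦(1 : ℤ)⟧) :=
    (shiftFunctor _ (1 : ℤ)).mapIso eX ≪≫ (Q.commShiftIso (1 : ℤ)).symm.app X
  -- The connecting morphism lifts to a chain map g, and the middle term is the cocone of g.
  -- Comparing the triangles rotated twice gives this after one shift, which is then undone.
  obtain ⟨g, hg⟩ := hY.isCbProj.Q_map_surjective (eY.inv ≫ T.mor₃ ≫ e.hom)
  let φ := isoTriangleOfIso₁₂ _ _ (rot_of_distTriang _ (rot_of_distTriang _ hT))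
    (rot_of_distTriang _ (mappingCocone_triangle_distinguished g)) eY e (by
      change T.mor₃ ≫ e.hom = eY.hom ≫ Q.map g
      rw [hg, Iso.hom_inv_id_assoc])
  exact ⟨_, hY.mappingCocone hX g, ⟨(shiftFunctor _ (1 : ℤ)).preimageIso (Triangle.π₃.mapIso φ)⟩⟩

theorem isQProjIoc.mono {a b a' b' : ℤ} {X : DerivedCategory (FGModuleCat.{u} A)}
    (hX : isQProjIoc A a b X) (ha : a' ≤ a) (hb : b ≤ b') : isQProjIoc A a' b' X := by
  obtain ⟨T, hT, e⟩ := hX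
  exact ⟨T, hT.mono ha hb, e⟩

/-- An object of cohomological degrees at most `b` is, up to an object of cohomological degrees
less than `b`, a finitely generated projective module placed in degree `b`. -/
theorem exists_triangle_single (X : DerivedCategory (FGModuleCat.{u} A)) (b : ℤ) [X.IsLE b] :
    ∃ (E C : DerivedCategory (FGModuleCat.{u} A)) (f : E ⟶ X) (g : X ⟶ C) (h : C ⟶ E⟦(1 : ℤ)⟧),
      Triangle.mk f g h ∈ distTriang _ ∧ isQProjIoc A (b - 1) b E ∧ C.IsLE (b - 1) := by
  obtain ⟨K, hK, ⟨e⟩⟩ := X.exists_iso_Q_obj_of_isLE b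
  obtain ⟨P, p, hP, hp⟩ := exists_projective_epi (K.X b)
  have hd : K.d b (b + 1) = 0 := (K.isZero_of_isStrictlyLE b (b + 1) (by omega)).eq_of_tgt _ _
  let S := (HomologicalComplex.single (FGModuleCat.{u} A) (ComplexShape.up ℤ) b).obj P
  let q : S ⟶ K := HomologicalComplex.mkHomFromSingle p (fun j hj => by
    obtain rfl : b + 1 = j := hj
    rw [hd, comp_zero])
  have hq : Epi (HomologicalComplex.homologyMap q b) := by
    have := K.isIso_iCycles b (b + 1) (by simp) hd
    have := S.isIso_iCycles b (b + 1) (by simp) (by simp [S])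
    have h1 : Epi (q.f b) := by
      rw [HomologicalComplex.mkHomFromSingle_f]
      infer_instance
    have h2 : Epi (HomologicalComplex.cyclesMap q b) := by
      have : HomologicalComplex.cyclesMap q b = (S.iCycles b ≫ q.f b) ≫ inv (K.iCycles b) := by
        rw [IsIso.eq_comp_inv, HomologicalComplex.cyclesMap_i]
      rw [this]
      infer_instance
    have h3 := HomologicalComplex.homologyπ_naturality q b
    have : Epi (S.homologyπ b ≫ HomologicalComplex.homologyMap q b) := by
      rw [h3]
      infer_instance
    exact epi_of_epi (S.homologyπ b) _
  obtain ⟨C, g, h, hT⟩ := distinguished_cocone_triangle (Q.map q ≫ e.inv)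
  have hS : isProjIoc A (b - 1) b S := isProjIoc_single b P
  refine ⟨Q.obj S, C, Q.map q ≫ e.inv, g, h, hT, ⟨S, hS, ⟨Iso.refl _⟩⟩, ?_⟩
  -- For i ≥ b the map H^i(X) → H^i(C) is epi because H^(i+1)(S) = 0. It is also zero: for i = b
  -- because H^b(S) → H^b(X) is epi, for i > b because H^i(X) = 0.
  rw [DerivedCategory.isLE_iff]
  intro i hi
  have hSi : IsZero ((homologyFunctor _ (i + 1)).obj (Q.obj S)) :=
    IsZero.of_iso (ShortComplex.isZero_homology_of_isZero_X₂ _ (hS.2 (i + 1) (by omega)))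
      ((homologyFunctorFactors _ (i + 1)).app S)
  have h1 : Epi ((homologyFunctor _ i).map g) :=
    (HomologySequence.epi_homologyMap_mor₂_iff _ hT i (i + 1)).mpr (hSi.eq_of_tgt _ _)
  have h2 : (homologyFunctor _ i).map g = 0 := by
    by_cases hib : i = b
    · subst hib
      refine (HomologySequence.epi_homologyMap_mor₁_iff _ hT i).mp ?_
      change Epi ((homologyFunctor _ i).map (Q.map q ≫ e.inv))
      have : Epi ((homologyFunctor _ i).map (Q.map q)) :=
        epi_of_comm_iso ((homologyFunctorFactors _ i).app S) ((homologyFunctorFactors _ i).app K)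
          (homologyFunctorFactors_hom_naturality q i) hq
      rw [Functor.map_comp]
      infer_instance
    · exact ((X.isLE_iff b).mp inferInstance i (by omega)).eq_of_src _ _
  rw [IsZero.iff_id_eq_zero, ← cancel_epi ((homologyFunctor _ i).map g), h2]
  simp

/-- An object of cohomological degrees at most `b` is approximated by a complex of finitely
generated projective modules which is concentrated in the degrees `b - n + 1, …, b`. -/
theorem exists_triangle_isQProjIoc (n : ℕ) (b : ℤ) (X : DerivedCategory (FGModuleCat.{u} A))
    [X.IsLE b] :
    ∃ (E C : DerivedCategory (FGModuleCat.{u} A)) (f : E ⟶ X) (g : X ⟶ C) (h : C ⟶ E⟦(1 : ℤ)⟧),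
      Triangle.mk f g h ∈ distTriang _ ∧ isQProjIoc A (b - n) b E ∧ C.IsLE (b - n) := by
  induction n generalizing b X with
  | zero =>
    refine ⟨0, X, 0, 𝟙 X, 0, contractible_distinguished₁ X, ⟨0, ?_, ⟨?_⟩⟩, by simpa⟩
    · have h0 : ∀ i, IsZero ((0 : CochainComplex (FGModuleCat.{u} A) ℤ).X i) := fun i =>
        (HomologicalComplex.eval _ _ i).map_isZero (isZero_zero _)
      refine ⟨fun i => ?_, fun i _ => h0 i⟩
      have := (isZero_iff_subsingleton _).mp (h0 i)
      infer_instance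
    · exact (isZero_zero _).iso (Q.map_isZero (isZero_zero _))
  | succ n ih =>
    obtain ⟨E₁, X₂, f₁, g₁, h₁, hT₁, hE₁, hX₂⟩ := exists_triangle_single X b
    obtain ⟨E₂, X₃, f₂, g₂, h₂, hT₂, hE₂, hX₃⟩ := ih (b - 1) X₂
    obtain ⟨E, f, h, hT⟩ := distinguished_cocone_triangle₁ (g₁ ≫ g₂)
    -- By the octahedral axiom the fibre E of X → X₃ is an extension of E₂ by E₁.
    have H := someOctahedron' rfl hT₁ hT₂ hT
    have he : b - 1 - n = b - (n + 1 : ℕ) := by push_cast; ring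
    rw [he] at hE₂ hX₃
    exact ⟨E, X₃, f, g₁ ≫ g₂, h, hT, isQProjIoc.ext _ H.mem
      (hE₁.mono (by omega) le_rfl) (hE₂.mono le_rfl (by omega)), hX₃⟩

/-- An object with cohomology in degrees `1, …, m` is the truncation of a complex of finitely
generated projective modules which is concentrated in the degrees `0, …, m`. -/
theorem exists_iso_truncGE (m : ℕ) (X : DerivedCategory (FGModuleCat.{u} A))
    [X.IsLE m] [X.IsGE 1] : ∃ T, isProjIoc A (-1) m T ∧
      Nonempty (X ≅ (TStructure.t.truncGE 1).obj (Q.obj T)) := by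
  obtain ⟨E, C, f, g, h, hT, ⟨T, hE, ⟨e⟩⟩, hC⟩ := exists_triangle_isQProjIoc (m + 1) m X
  have h1 : ((m : ℤ) - (m + 1 : ℕ)) = -1 := by push_cast; ring
  rw [h1] at hE hC
  refine ⟨T, hE, ⟨?_⟩⟩
  -- C⟦-1⟧ lies in degrees ≤ 0, so τ≥1 does not see it. Surplus cohomology of T in degree 0 is
  -- discarded too.
  have : IsIso ((TStructure.t.truncGE 1).map f) :=
    TStructure.t.isIso₂_truncGE_map_of_isLE _ (inv_rot_of_distTriang _ hT) 0 1 (by simp)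
      (TStructure.t.isLE_shift C (-1) (-1) 0 (by simp))
  exact asIso ((TStructure.t.truncGEπ 1).app X) ≪≫ (asIso ((TStructure.t.truncGE 1).map f)).symm ≪≫
    (TStructure.t.truncGE 1).mapIso e

end ProjectivePresentation

/-! ### Splitting off indecomposable summands. -/

section KrullSchmidt

open ZeroObject

theorem isProjIoc.of_retract {A : Type u} [Ring A] {a b : ℤ}
    {X Y : CochainComplex (FGModuleCat.{u} A) ℤ}
    (hX : isProjIoc A a b X) (r : Retract Y X) : isProjIoc A a b Y := by
  refine ⟨(hX.isCbProj.of_retract r).1, fun i hi => ?_⟩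
  have hr : r.i.f i ≫ r.r.f i = 𝟙 _ := by
    rw [← HomologicalComplex.comp_f, r.retract, HomologicalComplex.id_f]
  rw [IsZero.iff_id_eq_zero, ← hr, (hX.2 i hi).eq_of_tgt (r.i.f i) 0, zero_comp]

variable (k : Type w) [Field k] {A : Type u} [Ring A] [Algebra k A]

/-- The total dimension of a complex in the degrees `0, …, m`. -/
noncomputable def totalDim (m : ℕ) (X : CochainComplex (FGModuleCat.{u} A) ℤ) : ℕ :=
  ∑ i ∈ Finset.Icc (0 : ℤ) m, dimK k (X.X i)

theorem totalDim_eq_of_iso (m : ℕ) {X Y : CochainComplex (FGModuleCat.{u} A) ℤ} (e : X ≅ Y) :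
    totalDim k m X = totalDim k m Y :=
  Finset.sum_congr rfl fun i _ => dimK_eq_of_iso k ((HomologicalComplex.eval _ _ i).mapIso e)

variable [Module.Finite k A]

theorem isZero_of_totalDim_eq_zero {m : ℕ} {X : CochainComplex (FGModuleCat.{u} A) ℤ}
    (hX : isProjIoc A (-1) m X) (h : totalDim k m X = 0) : IsZero X := by
  rw [IsZero.iff_id_eq_zero]
  ext i : 1
  refine IsZero.eq_of_src ?_ _ _
  by_cases hi : i ∈ Finset.Icc (0 : ℤ) m
  · exact (dimK_eq_zero_iff k _).mp (Finset.sum_eq_zero_iff.mp h i hi)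
  · exact hX.2 i (by rw [Finset.mem_Icc] at hi; omega)

variable [IsNoetherianRing A]

theorem totalDim_biprod (m : ℕ) (X Y : CochainComplex (FGModuleCat.{u} A) ℤ) :
    totalDim k m (X ⊞ Y) = totalDim k m X + totalDim k m Y := by
  rw [totalDim, totalDim, totalDim, ← Finset.sum_add_distrib]
  refine Finset.sum_congr rfl fun i _ => ?_
  rw [← dimK_biprod]
  exact dimK_eq_of_iso k (HomologicalComplex.biprodXIso X Y i)

/-- A nonzero complex has an indecomposable direct summand. -/
theorem exists_indecomposable_summand (k : Type w) [Field k] {A : Type u} [Ring A] [Algebra k A]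
    [Module.Finite k A] [IsNoetherianRing A] {m : ℕ}
    {X : CochainComplex (FGModuleCat.{u} A) ℤ} (hX : isProjIoc A (-1) m X) (h0 : ¬ IsZero X) :
    ∃ S Y : CochainComplex (FGModuleCat.{u} A) ℤ, Indecomposable S ∧ Nonempty (X ≅ S ⊞ Y) := by
  induction hn : totalDim k m X using Nat.strong_induction_on generalizing X with
  | _ n ih =>
    subst hn
    by_cases hind : Indecomposable X
    · exact ⟨X, 0, hind, ⟨isoBiprodZero (isZero_zero _)⟩⟩
    · have : ∃ U V : CochainComplex (FGModuleCat.{u} A) ℤ, Nonempty (X ≅ U ⊞ V) ∧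
          ¬ IsZero U ∧ ¬ IsZero V := by
        by_contra! h
        refine hind ⟨h0, fun U V e => ?_⟩
        by_cases hU : IsZero U
        · exact Or.inl hU
        · exact Or.inr (h U V ⟨e⟩ hU)
      obtain ⟨U, V, ⟨e⟩, hU, hV⟩ := this
      have hUp : isProjIoc A (-1) m U :=
        hX.of_retract ⟨biprod.inl ≫ e.inv, e.hom ≫ biprod.fst, by simp⟩
      have hVp : isProjIoc A (-1) m V :=
        hX.of_retract ⟨biprod.inr ≫ e.inv, e.hom ≫ biprod.snd, by simp⟩
      have hdim := (totalDim_eq_of_iso k m e).trans (totalDim_biprod k m U V)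
      have hVd := mt (isZero_of_totalDim_eq_zero k hVp) hV
      obtain ⟨S, Y, hS, ⟨e'⟩⟩ := ih _ (by omega) hUp hU rfl
      exact ⟨S, Y ⊞ V, hS, ⟨e ≪≫ biprod.mapIso e' (Iso.refl V) ≪≫ biprod.associator S Y V⟩⟩

end KrullSchmidt

/-! ### Indecomposable complexes of projectives. -/

section Indecomposable

variable {A : Type u} [Ring A] [IsNoetherianRing A]

theorem Cm.isIndecomposable_of_indecomposable {m : ℕ} (X : Cm A m) (hX : Indecomposable X.obj) :
    IsIndecomposable X := by
  refine isIndecomposable_of_idempotents X (fun h => hX.1 ?_) fun e he => ?_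
  · exact (isCm A m).ι.map_isZero h
  · rcases ((isIndecomposable_iff X.obj).mpr hX).eq_zero_or_eq_id e.hom
      (congrArg (fun f => f.hom) he) with h | h
    · exact Or.inl (ObjectProperty.hom_ext _ h)
    · exact Or.inr (ObjectProperty.hom_ext _ h)

/-- An indecomposable complex of projective modules is homotopy minimal or contractible. -/
theorem isHomotopyMinimal_or_homotopy_zero [IsArtinianRing A]
    {X : CochainComplex (FGModuleCat.{u} A) ℤ}
    (hproj : ∀ i, Module.Projective A (X.X i)) (hX : Indecomposable X) :
    IsHomotopyMinimal X ∨ Nonempty (Homotopy (𝟙 X) 0) := by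
  by_contra! h
  obtain ⟨e, he0, he, hh⟩ := exists_homotopy_zero_of_not_isHomotopyMinimal hproj h.1
  rcases ((isIndecomposable_iff X).mpr hX).eq_zero_or_eq_id e he with h' | rfl
  · exact he0 h'
  · exact h.2.false hh.some

end Indecomposable

/-! ### Finite type of all C_m implies discreteness. -/

section Discrete

open DerivedCategory ZeroObject

variable (k : Type w) [Field k] {A : Type u} [Ring A] [Algebra k A]
  [IsNoetherianRing A] [HasDerivedCategory.{v} (FGModuleCat.{u} A)]

/-- The total dimension of the cohomology of an object in the degrees `1, …, m`. -/
noncomputable def totalDimH (m : ℕ) (X : DerivedCategory (FGModuleCat.{u} A)) : ℕ :=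
  ∑ i ∈ Finset.Icc (1 : ℤ) m, dimK k ((homologyFunctor _ i).obj X)

theorem totalDimH_eq_of_iso (m : ℕ) {X Y : DerivedCategory (FGModuleCat.{u} A)} (e : X ≅ Y) :
    totalDimH k m X = totalDimH k m Y :=
  Finset.sum_congr rfl fun i _ => dimK_eq_of_iso k ((homologyFunctor _ i).mapIso e)

variable [Module.Finite k A]

theorem totalDimH_biprod (m : ℕ) (X Y : DerivedCategory (FGModuleCat.{u} A)) :
    totalDimH k m (X ⊞ Y) = totalDimH k m X + totalDimH k m Y := by
  rw [totalDimH, totalDimH, totalDimH, ← Finset.sum_add_distrib]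
  refine Finset.sum_congr rfl fun i _ => ?_
  rw [← dimK_biprod]
  have := preservesBinaryBiproducts_of_preservesBiproducts (homologyFunctor (FGModuleCat.{u} A) i)
  exact dimK_eq_of_iso k ((homologyFunctor _ i).mapBiprod X Y)

theorem isZero_of_totalDimH_eq_zero {m : ℕ} {X : DerivedCategory (FGModuleCat.{u} A)}
    [X.IsGE 1] [X.IsLE m] (h : totalDimH k m X = 0) : IsZero X := by
  refine isZero_of_isZero_homology X fun i => ?_
  by_cases hi : i ∈ Finset.Icc (1 : ℤ) m
  · exact (dimK_eq_zero_iff k _).mp (Finset.sum_eq_zero_iff.mp h i hi)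
  · rw [Finset.mem_Icc, not_and_or] at hi
    rcases hi with hi | hi
    · exact X.isZero_of_isGE 1 i (by omega)
    · exact X.isZero_of_isLE m i (by omega)

/-- The direct sums of at most `n` objects of a set. -/
noncomputable def sumsLE {C : Type*} [Category* C] [Preadditive C] [HasZeroObject C]
    [HasBinaryBiproducts C] (s : Set C) : ℕ → Set C
  | 0 => {0}
  | n + 1 => sumsLE s n ∪ Set.image2 (fun X Y => X ⊞ Y) s (sumsLE s n)

theorem finite_sumsLE {C : Type*} [Category* C] [Preadditive C] [HasZeroObject C]
    [HasBinaryBiproducts C] {s : Set C} (hs : s.Finite) (n : ℕ) : (sumsLE s n).Finite := by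
  induction n with
  | zero => exact Set.finite_singleton _
  | succ n ih => exact ih.union (hs.image2 _ ih)

theorem zero_mem_sumsLE {C : Type*} [Category* C] [Preadditive C] [HasZeroObject C]
    [HasBinaryBiproducts C] (s : Set C) (n : ℕ) : (0 : C) ∈ sumsLE s n := by
  induction n with
  | zero => exact Set.mem_singleton _
  | succ n ih => exact Or.inl ih

variable (A) in
/-- The functor which sends a complex to its canonical truncation in degrees at least `1`. -/
noncomputable abbrev truncQ :
    CochainComplex (FGModuleCat.{u} A) ℤ ⥤ DerivedCategory (FGModuleCat.{u} A) :=
  Q ⋙ TStructure.t.truncGE 1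

theorem isLE_truncQ_obj {m : ℕ} {X : CochainComplex (FGModuleCat.{u} A) ℤ}
    (hX : isProjIoc A (-1) m X) : ((truncQ A).obj X).IsLE m := by
  have : X.IsStrictlyLE m := by
    rw [CochainComplex.isStrictlyLE_iff]
    exact fun i hi => hX.2 i (Or.inr hi)
  have : (Q.obj X).IsLE m := inferInstance
  exact inferInstanceAs (TStructure.t.IsLE ((TStructure.t.truncGE 1).obj (Q.obj X)) m)

theorem isZero_truncQ_obj_or_isHomotopyMinimal [IsArtinianRing A]
    {S : CochainComplex (FGModuleCat.{u} A) ℤ} (hproj : ∀ i, Module.Projective A (S.X i))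
    (hS : Indecomposable S) : IsZero ((truncQ A).obj S) ∨ IsHomotopyMinimal S := by
  rcases isHomotopyMinimal_or_homotopy_zero hproj hS with h | ⟨⟨h⟩⟩
  · exact Or.inr h
  · left
    have : Q.map (𝟙 S) = 0 := (Q_map_eq_of_homotopy _ h).trans (Functor.map_zero _ _ _)
    rw [Q.map_id] at this
    exact (TStructure.t.truncGE 1).map_isZero ((IsZero.iff_id_eq_zero _).mpr this)

/-- If `C_m(A-proj)` is of finite representation type, then the truncations of the complexes of
projective modules in degrees `0, …, m` are direct sums of objects of a finite set, where the
number of summands is bounded by the total dimension of the cohomology. -/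
theorem exists_iso_sumsLE [IsArtinianRing A] {m : ℕ} (s : Set (Cm A m))
    (hs : ∀ X : Cm A m, IsIndecomposable X → ∃ Y ∈ s, Isomorphic X Y)
    {T : CochainComplex (FGModuleCat.{u} A) ℤ} (hT : isProjIoc A (-1) m T) (n : ℕ)
    (hn : totalDimH k m ((truncQ A).obj T) ≤ n) :
    ∃ Y ∈ sumsLE ((fun S : Cm A m => (truncQ A).obj S.obj) '' s) n,
      Nonempty ((truncQ A).obj T ≅ Y) := by
  -- The dimension of T drops with each summand removed, whereas n drops only when that summand
  -- survives truncation.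
  induction hd : totalDim k m T using Nat.strong_induction_on generalizing T n with
  | _ d ih =>
    subst hd
    by_cases hT0 : IsZero T
    · exact ⟨0, zero_mem_sumsLE _ _, ⟨((truncQ A).map_isZero hT0).iso (isZero_zero _)⟩⟩
    obtain ⟨S, T', hS, ⟨e⟩⟩ := exists_indecomposable_summand k hT hT0
    have hSp : isProjIoc A (-1) m S :=
      hT.of_retract ⟨biprod.inl ≫ e.inv, e.hom ≫ biprod.fst, by simp⟩
    have hT'p : isProjIoc A (-1) m T' :=
      hT.of_retract ⟨biprod.inr ≫ e.inv, e.hom ≫ biprod.snd, by simp⟩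
    have hdim := (totalDim_eq_of_iso k m e).trans (totalDim_biprod k m S T')
    have hSd := mt (isZero_of_totalDim_eq_zero k hSp) hS.1
    have := preservesBinaryBiproducts_of_preservesBiproducts (truncQ A)
    let φ : (truncQ A).obj T ≅ (truncQ A).obj S ⊞ (truncQ A).obj T' :=
      (truncQ A).mapIso e ≪≫ (truncQ A).mapBiprod S T'
    have hdimH := (totalDimH_eq_of_iso k m φ).trans (totalDimH_biprod k m _ _)
    by_cases hS0 : IsZero ((truncQ A).obj S)
    · obtain ⟨Y, hY, ⟨ψ⟩⟩ := ih _ (by omega) hT'p n (by omega) rfl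
      exact ⟨Y, hY, ⟨φ ≪≫ (isoZeroBiprod hS0).symm ≪≫ ψ⟩⟩
    · have hmin := (isZero_truncQ_obj_or_isHomotopyMinimal hSp.1 hS).resolve_left hS0
      let S' : Cm A m := ⟨S, hSp.isCbProj, hmin, fun i hi => hSp.2 i (by omega)⟩
      obtain ⟨S₀, hS₀, ⟨ε⟩⟩ := hs S' (Cm.isIndecomposable_of_indecomposable S' hS)
      have := isLE_truncQ_obj hSp
      have : ((truncQ A).obj S).IsGE 1 :=
        inferInstanceAs (TStructure.t.IsGE ((TStructure.t.truncGE 1).obj (Q.obj S)) 1)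
      -- A surviving summand uses up at least one dimension of cohomology, so n is positive.
      have hpos := mt (isZero_of_totalDimH_eq_zero k (m := m)) hS0
      obtain ⟨n, rfl⟩ : ∃ p, n = p + 1 := ⟨n - 1, by omega⟩
      obtain ⟨Y, hY, ⟨ψ⟩⟩ := ih _ (by omega) hT'p n (by omega) rfl
      exact ⟨_, Or.inr ⟨_, ⟨S₀, hS₀, rfl⟩, Y, hY, rfl⟩,
        ⟨φ ≪≫ biprod.mapIso ((truncQ A).mapIso ((isCm A m).ι.mapIso ε)) ψ⟩⟩

/-- If all `C_m(A-proj)` are of finite representation type, then the objects of `D^b(A-mod)` with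
a given cohomology dimension vector are, up to a fixed shift, covered by a finite set. -/
theorem exists_finite_cover_of_cmFinite [IsArtinianRing A] (hfin : ∀ m : ℕ, 1 ≤ m → CmFinite A m)
    (h : ℤ → ℕ) : ∃ (t : Set (DerivedCategory (FGModuleCat.{u} A))) (c : ℤ), t.Finite ∧
      ∀ X : Db.{v} A, Db.dimH k X = h → ∃ Y ∈ t, Nonempty (X.obj⟦c⟧ ≅ Y) := by
  by_cases hne : ∃ X : Db.{v} A, Db.dimH k X = h
  swap
  · exact ⟨∅, 0, Set.finite_empty, fun X hX => absurd ⟨X, hX⟩ hne⟩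
  obtain ⟨X₀, hX₀⟩ := hne
  obtain ⟨⟨a, ha⟩, ⟨b, hb⟩⟩ := X₀.property
  have hsupp : ∀ i, i < a ∨ b < i → h i = 0 := by
    intro i hi
    rw [← hX₀]
    refine (dimK_eq_zero_iff k _).mpr ?_
    rcases hi with hi | hi
    · exact X₀.obj.isZero_of_isGE a i hi
    · exact X₀.obj.isZero_of_isLE b i hi
  -- The shift by a - 1 moves the degrees a, …, b to 1, …, b - a + 1. The maximum secures m ≥ 1, as
  -- `hfin` demands.
  let m : ℕ := max 1 (b - (a - 1)).toNat
  obtain ⟨s, hs, hcov⟩ := hfin m (le_max_left _ _)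
  refine ⟨sumsLE ((fun S : Cm A m => (truncQ A).obj S.obj) '' s)
    (∑ i ∈ Finset.Icc (1 : ℤ) m, h (i + (a - 1))), a - 1, finite_sumsLE (hs.image _) _, ?_⟩
  intro X hX
  have e : ∀ i, (homologyFunctor _ i).obj (X.obj⟦a - 1⟧) ≅
      (homologyFunctor _ (i + (a - 1))).obj X.obj := fun i =>
    ((homologyFunctor (FGModuleCat.{u} A) 0).shiftIso (a - 1) i (i + (a - 1))
      (add_comm _ _)).app X.obj
  have hdim : ∀ i, dimK k ((homologyFunctor _ i).obj (X.obj⟦a - 1⟧)) = h (i + (a - 1)) := fun i =>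
    (dimK_eq_of_iso k (e i)).trans (congrFun hX _)
  have hm : b - (a - 1) ≤ m := by
    have := le_max_right 1 (b - (a - 1)).toNat
    omega
  have hGE : (X.obj⟦a - 1⟧).IsGE 1 := (isGE_iff _ _).mpr fun i hi =>
    (dimK_eq_zero_iff k _).mp ((hdim i).trans (hsupp _ (by omega)))
  have hLE : (X.obj⟦a - 1⟧).IsLE m := (isLE_iff _ _).mpr fun i hi =>
    (dimK_eq_zero_iff k _).mp ((hdim i).trans (hsupp _ (by omega)))
  obtain ⟨T, hT, ⟨φ⟩⟩ := exists_iso_truncGE m (X.obj⟦a - 1⟧)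
  obtain ⟨Y, hY, ⟨ψ⟩⟩ := exists_iso_sumsLE k s hcov hT _
    ((totalDimH_eq_of_iso k m φ).symm.le.trans (Finset.sum_congr rfl fun i _ => hdim i).le)
  exact ⟨Y, hY, ⟨φ ≪≫ ψ⟩⟩

theorem derivedDiscrete_of_cmFinite [IsArtinianRing A] (hfin : ∀ m : ℕ, 1 ≤ m → CmFinite A m) :
    DerivedDiscrete.{v} k A := by
  intro h
  obtain ⟨t, c, ht, hcov⟩ := exists_finite_cover_of_cmFinite.{v} k hfin h
  refine finitelyManyUpTo_of_cover (fun X Y => Nonempty (X.obj⟦c⟧ ≅ Y)) t ht hcov ?_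
  rintro X X' Y - - ⟨e⟩ ⟨e'⟩
  exact ⟨ObjectProperty.isoMk _ ((shiftFunctor _ c).preimageIso (e ≪≫ e'.symm))⟩

end Discrete

/-- The finite cover in D^b also serves K^b, since `Kb.toDb` is fully faithful and preserves the
cohomology vector. -/
theorem kbDiscrete_of_cmFinite (k : Type w) [Field k] {A : Type u} [Ring A] [Algebra k A]
    [IsNoetherianRing A] [Module.Finite k A] [IsArtinianRing A]
    (hfin : ∀ m : ℕ, 1 ≤ m → CmFinite A m) : KbDiscrete k A := by
  let := HasDerivedCategory.standard (FGModuleCat.{u} A)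
  intro h
  obtain ⟨t, c, ht, hcov⟩ := exists_finite_cover_of_cmFinite k hfin h
  refine finitelyManyUpTo_of_cover (fun X Y => Nonempty (((Kb.toDb A).obj X).obj⟦c⟧ ≅ Y)) t ht
    (fun X hX => hcov _ ((Kb.dimH_toDb_obj k X).trans hX)) ?_
  rintro X X' Y - - ⟨e⟩ ⟨e'⟩
  exact ⟨(Kb.toDb A).preimageIso (ObjectProperty.isoMk _
    ((shiftFunctor _ c).preimageIso (e ≪≫ e'.symm)))⟩

end DerivedRepType

theorem mainTheorem4 (k : Type w) [Field k] (A : Type u) [Ring A] [Algebra k A]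
    [Module.Finite k A] :
    haveI : IsNoetherianRing A := IsNoetherianRing.of_finite k A
    ∀ [HasDerivedCategory.{v} (FGModuleCat.{u} A)],
      DerivedRepType.IsCDichotomic k A →
        (DerivedRepType.KbDiscrete k A ∨ DerivedRepType.KbStronglyUnbounded k A) ∧
        (DerivedRepType.DerivedDiscrete.{v} k A ∨
          DerivedRepType.StronglyDerivedUnbounded.{v} k A) := by
  have : IsNoetherianRing A := IsNoetherianRing.of_finite k A
  have : IsArtinianRing A := IsArtinianRing.of_finite k A
  intro _ h
  rcases h with h | ⟨m, -, h⟩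
  · exact ⟨Or.inl (DerivedRepType.kbDiscrete_of_cmFinite k h),
      Or.inl (DerivedRepType.derivedDiscrete_of_cmFinite k h)⟩
  · exact ⟨Or.inr (DerivedRepType.kbStronglyUnbounded_of_cm k h),
      Or.inr (DerivedRepType.stronglyDerivedUnbounded_of_cm k h)⟩
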